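/- All graphs are finite, simple and undirected. For a graph $G=(V,E)$, the Mycielski graph $M(G)$ has vertex set $V\cup V'\cup\{u\}$, where $V'=\{v' : v\in V\}$ is a disjoint copy of $V$ and $u$ is a new vertex, and edge set $E\cup\{vw' : vw\in E\}\cup\{v'u : v'\in V'\}$ (here, for $vw\in E$, both $vw'$ and $wv'$ are edges); put $M^0(G)=G$ and $M^{t}(G)=M(M^{t-1}(G))$ for $t\ge 1$. An $L(2,1)$-labeling of a graph $H$ is a function $f$ from its vertices to the nonnegative integers with $|f(x)-f(y)|\ge 2$ if $d_H(x,y)=1$ and $|f(x)-f(y)|\ge 1$ if $d_H(x,y)=2$; $\lambda(H)$ is the least $k$ such that $H$ has an $L(2,1)$-labeling with no label greater than $k$. **Theorem.** Let $G=(V,E)$ be a graph without isolated vertices, of order $n\ge 2$, and let $t\ge 2$. Then $$\lambda(M^t(G))=2^{t-1}(n+2)-2$$ if and only if $|D_2(S)|\ge |S|$ for every $S\subseteq V$, where $D_2(S)=\{x\in V : \exists v\in S,\ d_G(x,v)>2\}$ (vertices in different components being at infinite distance). Moreover, the condition that $|D_2(S)|\ge|S|$ for every $S\subseteq V$ holds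 if and only if the graph $\overline{G^2}$, in which two distinct vertices are adjacent exactly when their distance in $G$ is greater than $2$, has a perfect $2$-matching, i.e. an assignment of weights $0$, $1$ or $2$ to its edges such that the weights of the edges incident to each vertex sum to exactly $2$. -/

import Mathlib

namespace L21Mycielski

universe u

/-- The vertex set `V ∪ V' ∪ {u}` of the Mycielski graph: `inl v` is the original vertex `v`,
`inr (inl v)` is its copy `v'`, and `inr (inr ())` is the root `u`. -/
abbrev MycielskiVertex (V : Type u) : Type u := V ⊕ V ⊕ Unit

/-- Adjacency in the Mycielski graph: `E`, the pairs `v w'` and `v' w` with `v w ∈ E`,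
and the pairs `v' u`. -/
def mycielskiAdj {V : Type u} (G : SimpleGraph V) :
    MycielskiVertex V → MycielskiVertex V → Prop
  | .inl v, .inl w => G.Adj v w
  | .inl v, .inr (.inl w) => G.Adj v w
  | .inr (.inl v), .inl w => G.Adj v w
  | .inr (.inl _), .inr (.inr _) => True
  | .inr (.inr _), .inr (.inl _) => True
  | _, _ => False

/-- The Mycielski graph `M(G)`. -/
def mycielski {V : Type u} (G : SimpleGraph V) : SimpleGraph (MycielskiVertex V) where
  Adj := mycielskiAdj G
  symm := ⟨by
    rintro (v | v | v) (w | w | w) h <;>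
      first | exact SimpleGraph.Adj.symm (G := G) h | exact h⟩
  loopless := ⟨by
    rintro (v | v | v) h
    · exact G.irrefl h
    · exact h
    · exact h⟩

/-- The vertex set of the `t`-th iterated Mycielski graph. -/
def IterVertex (V : Type u) : ℕ → Type u
  | 0 => V
  | t + 1 => MycielskiVertex (IterVertex V t)

/-- The `t`-th iterated Mycielski graph: `M⁰(G) = G` and `M^(t+1)(G) = M(M^t(G))`. -/
def iterMycielski {V : Type u} (G : SimpleGraph V) : (t : ℕ) → SimpleGraph (IterVertex V t)
  | 0 => G
  | t + 1 => mycielski (iterMycielski G t)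

/-- `f` is an `L(2,1)`-labeling of `G`. -/
def IsL21Labeling {V : Type u} (G : SimpleGraph V) (f : V → ℕ) : Prop :=
  ∀ x y : V,
    (G.edist x y = 1 → 2 ≤ |(f x : ℤ) - (f y : ℤ)|) ∧
    (G.edist x y = 2 → 1 ≤ |(f x : ℤ) - (f y : ℤ)|)

/-- `G` has an `L(2,1)`-labeling with no label greater than `k`. -/
def HasL21Labeling {V : Type u} (G : SimpleGraph V) (k : ℕ) : Prop :=
  ∃ f : V → ℕ, IsL21Labeling G f ∧ ∀ x, f x ≤ k

/-- On a finite graph some `k` admits a labeling, so the minimum below is taken over a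
non-empty set. -/
theorem exists_hasL21Labeling {V : Type u} [Finite V] (G : SimpleGraph V) :
    ∃ k, HasL21Labeling G k := by
  obtain ⟨n, ⟨e⟩⟩ := Finite.exists_equiv_fin V
  have key : ∀ x y : V, x ≠ y →
      2 ≤ |((2 * (e x : ℕ) : ℕ) : ℤ) - ((2 * (e y : ℕ) : ℕ) : ℤ)| := by
    intro x y hxy
    have h : (e x : ℕ) ≠ (e y : ℕ) := fun h => hxy (e.injective (Fin.ext h))
    rw [le_abs]
    omega
  refine ⟨2 * n, fun x => 2 * (e x : ℕ), fun x y => ⟨fun h => ?_, fun h => ?_⟩, fun x => ?_⟩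
  · exact key x y (by rintro rfl; simp at h)
  · exact le_trans (by norm_num) (key x y (by rintro rfl; simp at h))
  · have := (e x).isLt
    simp only
    omega

/-- The `L(2,1)`-labeling number `λ(G)`: the least `k` such that `G` has an
`L(2,1)`-labeling with no label greater than `k`. -/
noncomputable def lambdaNumber {V : Type u} (G : SimpleGraph V) : ℕ :=
  sInf {k | HasL21Labeling G k}

/-- `D₂(S)`: the vertices at distance greater than `2` from some vertex of `S`; vertices in
different components are at infinite distance. -/
def D₂ {V : Type u} (G : SimpleGraph V) (S : Set V) : Set V :=
  {x | ∃ v ∈ S, 2 < G.edist x v}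

/-- The square `G²`: distinct vertices at distance at most `2` in `G` are joined. -/
def square {V : Type u} (G : SimpleGraph V) : SimpleGraph V where
  Adj x y := x ≠ y ∧ G.edist x y ≤ 2
  symm := ⟨fun x y h => ⟨h.1.symm, by rw [SimpleGraph.edist_comm]; exact h.2⟩⟩
  loopless := ⟨fun _ h => h.1 rfl⟩

/-- `G` has a perfect `2`-matching: weights `0`, `1`, `2` on the edges of `G` such that the
weights of the edges incident to each vertex sum to exactly `2`. The weight is extended by `0`
to the pairs that are not edges (loops included), and `∑ y, w s(x, y)` runs exactly once
through each edge incident to `x`. -/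
def HasPerfectTwoMatching {V : Type u} [Fintype V] (G : SimpleGraph V) : Prop :=
  ∃ w : Sym2 V → ℕ,
    (∀ e, w e ≤ 2) ∧ (∀ e, e ∉ G.edgeSet → w e = 0) ∧ ∀ x, ∑ y, w s(x, y) = 2

end L21Mycielski

namespace L21Mycielski

universe u

variable {V : Type u} {G : SimpleGraph V}

/-! Everything reduces to whether `V` has a permutation `p` moving each vertex to distance greater
than two. By Hall's theorem this is the condition on `D₂`; giving `x y` one unit of weight for each
of `p x = y`, `p y = x` yields a perfect `2`-matching, and double counting leads from a `2`-matching
back to Hall's condition.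

Lower bound: in `M^t(G)` the last copies, the last root and the earlier roots with their copies are
pairwise near. They number `2^(t-1) * (n+2) - 1` and need distinct labels. In case of equality they
use every label, so the vertices outside must share labels with them; following the vertices that
are copies at every step but the last produces `p` (`exists_injective_of_hasL21Labeling`).

Upper bound: given `p`, the vertices of `M²(G)` other than the roots and their copies split into
`2n` far pairs. A Hamiltonian path through these pairs, consecutive ones having no edge between
them, orders the labels (`IsPartialPath.extend`, `exists_numbering`). Further Mycielski steps keep
the bound sharp by splitting each label class in two (`HasSplitLabeling.mycielski`). -/

/-- Two vertices are near if they are at distance at most `2`. -/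
def Near (G : SimpleGraph V) (x y : V) : Prop :=
  x = y ∨ G.Adj x y ∨ ∃ z, G.Adj x z ∧ G.Adj z y

theorem Near.refl (x : V) : Near G x x := Or.inl rfl

theorem Near.symm {x y : V} (h : Near G x y) : Near G y x := by
  rcases h with rfl | h | ⟨z, h₁, h₂⟩
  · exact Or.inl rfl
  · exact Or.inr (Or.inl h.symm)
  · exact Or.inr (Or.inr ⟨z, h₂.symm, h₁.symm⟩)

theorem edist_le_two_iff_near {x y : V} : G.edist x y ≤ 2 ↔ Near G x y := by
  constructor
  · intro h
    have hr : G.Reachable x y := SimpleGraph.reachable_of_edist_ne_top (by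
      intro h'
      rw [h'] at h
      exact absurd h (by decide))
    obtain ⟨p, hp⟩ := hr.exists_walk_length_eq_edist
    rw [← hp] at h
    have h2 : p.length ≤ 2 := by exact_mod_cast h
    cases p with
    | nil => exact Or.inl rfl
    | cons h₁ q =>
      cases q with
      | nil => exact Or.inr (Or.inl h₁)
      | cons h₂ r =>
        cases r with
        | nil => exact Or.inr (Or.inr ⟨_, h₁, h₂⟩)
        | cons h₃ s => simp only [SimpleGraph.Walk.length_cons] at h2; omega
  · rintro (rfl | h | ⟨z, h₁, h₂⟩)
    · simp
    · rw [SimpleGraph.edist_eq_one_iff_adj.mpr h]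
      decide
    · simpa using SimpleGraph.edist_le (.cons h₁ (.cons h₂ .nil))

theorem two_lt_edist_iff_not_near {x y : V} : 2 < G.edist x y ↔ ¬ Near G x y := by
  rw [← edist_le_two_iff_near, not_le]

/-- A gap of two already rules out equal labels on an edge, so the distance-two condition may be
imposed on all near pairs. -/
theorem isL21Labeling_iff {f : V → ℕ} : IsL21Labeling G f ↔
    (∀ x y, G.Adj x y → f x + 2 ≤ f y ∨ f y + 2 ≤ f x) ∧
      ∀ x y, Near G x y → f x = f y → x = y := by
  constructor
  · intro h
    refine ⟨fun x y hxy => ?_, fun x y hn he => ?_⟩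
    · have := (h x y).1 (SimpleGraph.edist_eq_one_iff_adj.mpr hxy)
      rw [le_abs] at this
      omega
    · by_contra hne
      have h2 := edist_le_two_iff_near.mpr hn
      rcases h2.lt_or_eq with hlt | heq
      · have h1 : G.edist x y ≤ 1 := by
          have : (2 : ℕ∞) = 1 + 1 := by norm_num
          rw [this] at hlt
          exact Order.le_of_lt_add_one hlt
        have h0 : 1 ≤ G.edist x y := by
          rw [Order.one_le_iff_ne_zero]
          simpa using hne
        have := (h x y).1 (le_antisymm h1 h0)
        rw [he] at this
        simp at this
      · have := (h x y).2 heq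
        rw [he] at this
        simp at this
  · rintro ⟨h₁, h₂⟩ x y
    refine ⟨fun h => ?_, fun h => ?_⟩
    · have := h₁ x y (SimpleGraph.edist_eq_one_iff_adj.mp h)
      rw [le_abs]
      omega
    · have hne : x ≠ y := by
        rintro rfl
        simp at h
      have := mt (h₂ x y (edist_le_two_iff_near.mp h.le)) hne
      rw [le_abs]
      omega

/-! ### The Mycielski graph -/

/-- No vertex of the graph is isolated. -/
def NoIsolated (G : SimpleGraph V) : Prop := ∀ v, ∃ w, G.Adj v w

section Mycielski

theorem not_mycielski_adj_copy_copy {v w : V} :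
    ¬ (mycielski G).Adj (.inr (.inl v)) (.inr (.inl w)) := id

theorem not_mycielski_adj_inl_root {v : V} {a : Unit} :
    ¬ (mycielski G).Adj (.inl v) (.inr (.inr a)) := id

theorem NoIsolated.mycielski [Nonempty V] (hG : NoIsolated G) :
    NoIsolated (mycielski G) := by
  rintro (v | v | a)
  · obtain ⟨w, h⟩ := hG v
    exact ⟨.inl w, h⟩
  · exact ⟨.inr (.inr ()), trivial⟩
  · exact ⟨.inr (.inl (Classical.arbitrary V)), trivial⟩

theorem near_inl_inl {v w : V} :
    Near (mycielski G) (.inl v) (.inl w) ↔ Near G v w := by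
  constructor
  · rintro (h | h | ⟨z | z | z, h₁, h₂⟩)
    · exact Or.inl (Sum.inl_injective h)
    · exact Or.inr (Or.inl h)
    · exact Or.inr (Or.inr ⟨z, h₁, h₂⟩)
    · exact Or.inr (Or.inr ⟨z, h₁, h₂⟩)
    · exact absurd h₁ not_mycielski_adj_inl_root
  · rintro (rfl | h | ⟨z, h₁, h₂⟩)
    · exact Or.inl rfl
    · exact Or.inr (Or.inl h)
    · exact Or.inr (Or.inr ⟨.inl z, h₁, h₂⟩)

/-- A vertex and its own copy share every neighbour of the vertex; this is where isolated vertices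
must be excluded. -/
theorem near_inl_copy (hG : NoIsolated G) {v w : V} :
    Near (mycielski G) (.inl v) (.inr (.inl w)) ↔ Near G v w := by
  constructor
  · rintro (h | h | ⟨z | z | z, h₁, h₂⟩)
    · cases h
    · exact Or.inr (Or.inl h)
    · exact Or.inr (Or.inr ⟨z, h₁, h₂⟩)
    · exact absurd h₂ not_mycielski_adj_copy_copy
    · exact absurd h₁ not_mycielski_adj_inl_root
  · rintro (rfl | h | ⟨z, h₁, h₂⟩)
    · obtain ⟨z, hz⟩ := hG v
      exact Or.inr (Or.inr ⟨.inl z, hz, hz.symm⟩)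
    · exact Or.inr (Or.inl h)
    · exact Or.inr (Or.inr ⟨.inl z, h₁, h₂⟩)

theorem near_copy_copy {v w : V} :
    Near (mycielski G) (.inr (.inl v)) (.inr (.inl w)) :=
  Or.inr (Or.inr ⟨.inr (.inr ()), trivial, trivial⟩)

theorem near_root (hG : NoIsolated G) (a : Unit) (x : MycielskiVertex V) :
    Near (mycielski G) (.inr (.inr a)) x := by
  rcases x with v | v | b
  · obtain ⟨w, h⟩ := hG v
    exact Or.inr (Or.inr ⟨.inr (.inl w), trivial, h.symm⟩)
  · exact Or.inr (Or.inl trivial)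
  · exact Or.inl rfl

end Mycielski

/-! ### Iterated Mycielski graphs -/

instance (t : ℕ) [Nonempty V] : Nonempty (IterVertex V t) := by
  induction t with
  | zero => assumption
  | succ t ih => exact ⟨.inr (.inr ())⟩

instance (t : ℕ) [Finite V] : Finite (IterVertex V t) := by
  induction t with
  | zero => assumption
  | succ t ih => exact inferInstanceAs (Finite (IterVertex V t ⊕ IterVertex V t ⊕ Unit))

theorem NoIsolated.iterMycielski [Nonempty V] (hG : NoIsolated G) (t : ℕ) :
    NoIsolated (iterMycielski G t) := by
  induction t with
  | zero => exact hG
  | succ t ih => exact ih.mycielski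

theorem card_iterVertex_add_one (V : Type u) [Finite V] (t : ℕ) :
    Nat.card (IterVertex V t) + 1 = 2 ^ t * (Nat.card V + 1) := by
  induction t with
  | zero => simp [IterVertex]
  | succ t ih =>
    have : Nat.card (IterVertex V (t + 1))
        = Nat.card (IterVertex V t) + (Nat.card (IterVertex V t) + 1) := by
      change Nat.card (IterVertex V t ⊕ IterVertex V t ⊕ Unit) = _
      simp [Nat.card_sum]
    rw [this, pow_succ]
    linarith

/-- The roots of the iterated Mycielski graph and all their copies. -/
def IsRoot : (t : ℕ) → IterVertex V t → Prop
  | 0, _ => False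
  | t + 1, .inl x => IsRoot t x
  | t + 1, .inr (.inl x) => IsRoot t x
  | _ + 1, .inr (.inr _) => True

theorem card_isRoot_add_one (V : Type u) [Finite V] (t : ℕ) :
    Nat.card {x : IterVertex V t // IsRoot t x} + 1 = 2 ^ t := by
  induction t with
  | zero => simp [IsRoot]
  | succ t ih =>
    have e : {x : IterVertex V (t + 1) // IsRoot (t + 1) x} ≃
        {x : IterVertex V t // IsRoot t x} ⊕ {x : IterVertex V t // IsRoot t x} ⊕ Unit :=
      (Equiv.subtypeSum (p := fun x : MycielskiVertex (IterVertex V t) =>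
        IsRoot (t + 1) x)).trans <| (Equiv.refl _).sumCongr <|
        (Equiv.subtypeSum (p := fun x : IterVertex V t ⊕ Unit =>
          IsRoot (t + 1) (.inr x))).trans <| (Equiv.refl _).sumCongr <|
          Equiv.subtypeUnivEquiv (fun _ => trivial)
    rw [Nat.card_congr e, Nat.card_sum, Nat.card_sum, pow_succ]
    simp only [Nat.card_eq_fintype_card (α := Unit), Fintype.card_unit]
    omega

theorem IsRoot.near [Nonempty V] (hG : NoIsolated G) {t : ℕ} {x : IterVertex V t}
    (hx : IsRoot t x) (y : IterVertex V t) : Near (iterMycielski G t) x y := by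
  induction t with
  | zero => exact hx.elim
  | succ t ih =>
    have hH := hG.iterMycielski t
    rcases x with x | x | a
    · rcases y with y | y | b
      · exact near_inl_inl.mpr (ih hx y)
      · exact (near_inl_copy hH).mpr (ih hx y)
      · exact (near_root hH b _).symm
    · rcases y with y | y | b
      · exact ((near_inl_copy hH).mpr (ih hx y).symm).symm
      · exact near_copy_copy
      · exact (near_root hH b _).symm
    · exact near_root hH a y

/-- The vertex over `v` that is an original vertex at every step of the iteration. -/
def botVertex (v : V) : (t : ℕ) → IterVertex V t
  | 0 => v
  | t + 1 => .inl (botVertex v t)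

/-- The vertex over `v` that is a copy at every step of the iteration. -/
def topVertex (v : V) : (t : ℕ) → IterVertex V t
  | 0 => v
  | t + 1 => .inr (.inl (topVertex v t))

theorem not_isRoot_topVertex (v : V) (t : ℕ) : ¬ IsRoot t (topVertex v t) := by
  induction t with
  | zero => exact id
  | succ t ih => exact ih

/-- Copies made in the same step meet at its root, and that root is near everything. Hence a vertex
far from an iterated copy is an original at each step. -/
theorem exists_eq_botVertex_of_not_near_topVertex [Nonempty V] (hG : NoIsolated G) {t : ℕ}
    {v : V} {y : IterVertex V t} (h : ¬ Near (iterMycielski G t) (topVertex v t) y) :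
    ∃ w, y = botVertex w t ∧ ¬ Near G v w := by
  induction t with
  | zero => exact ⟨y, rfl, h⟩
  | succ t ih =>
    have hH := hG.iterMycielski t
    rcases y with y | y | b
    · obtain ⟨w, hw, hn⟩ := ih (y := y) fun h' => h ((near_inl_copy hH).mpr h'.symm).symm
      exact ⟨w, congrArg Sum.inl hw, hn⟩
    · exact absurd near_copy_copy h
    · exact absurd (near_root hH b _).symm h

/-! ### The lower bound -/

/-- The copies made in the last step, the last root, and the earlier roots with their copies:
a set of vertices pairwise at distance at most `2`. -/
def IsCore {t : ℕ} : IterVertex V (t + 1) → Prop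
  | .inl x => IsRoot t x
  | .inr _ => True

theorem card_isCore_add_one (V : Type u) [Finite V] (t : ℕ) :
    Nat.card {x : IterVertex V (t + 1) // IsCore x} + 1 = 2 ^ t * (Nat.card V + 2) := by
  have e : {x : IterVertex V (t + 1) // IsCore x} ≃
      {x : IterVertex V t // IsRoot t x} ⊕ IterVertex V t ⊕ Unit :=
    (Equiv.subtypeSum (p := fun x : MycielskiVertex (IterVertex V t) =>
      IsCore (t := t) x)).trans <| (Equiv.refl _).sumCongr <|
      Equiv.subtypeUnivEquiv (fun _ => trivial)
  rw [Nat.card_congr e, Nat.card_sum, Nat.card_sum]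
  have h₁ := card_iterVertex_add_one V t
  have h₂ := card_isRoot_add_one V t
  simp only [Nat.card_eq_fintype_card (α := Unit), Fintype.card_unit]
  linarith

theorem IsCore.near [Nonempty V] (hG : NoIsolated G) {t : ℕ} {x y : IterVertex V (t + 1)}
    (hx : IsCore x) (hy : IsCore y) : Near (iterMycielski G (t + 1)) x y := by
  have hH := hG.iterMycielski t
  rcases x with x | x | a
  · exact IsRoot.near (t := t + 1) (x := .inl x) hG (show IsRoot t x from hx) y
  · rcases y with y | y | b
    · exact (IsRoot.near (t := t + 1) (x := .inl y) hG (show IsRoot t y from hy) _).symm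
    · exact near_copy_copy
    · exact (near_root hH b _).symm
  · exact near_root hH a y

theorem core_label_injective [Nonempty V] (hG : NoIsolated G) {t : ℕ}
    {f : IterVertex V (t + 1) → ℕ} (hf : IsL21Labeling (iterMycielski G (t + 1)) f) {k : ℕ}
    (hk : ∀ x, f x ≤ k) : Function.Injective
      fun x : {x : IterVertex V (t + 1) // IsCore x} => (⟨f x, Nat.lt_succ_of_le (hk x)⟩ :
        Fin (k + 1)) := by
  intro x y h
  exact Subtype.ext
    ((isL21Labeling_iff.mp hf).2 x y (IsCore.near hG x.2 y.2) (congrArg Fin.val h))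

theorem le_of_hasL21Labeling [Nonempty V] [Finite V] (hG : NoIsolated G) {t k : ℕ}
    (h : HasL21Labeling (iterMycielski G (t + 1)) k) : 2 ^ t * (Nat.card V + 2) - 2 ≤ k := by
  obtain ⟨f, hf, hk⟩ := h
  have h₁ := Nat.card_le_card_of_injective _ (core_label_injective hG hf hk)
  have h₂ := card_isCore_add_one V t
  rw [Nat.card_fin] at h₁
  omega

theorem exists_injective_of_hasL21Labeling [Nonempty V] [Finite V] (hG : NoIsolated G) {t : ℕ}
    (h : HasL21Labeling (iterMycielski G (t + 2)) (2 ^ (t + 1) * (Nat.card V + 2) - 2)) :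
    ∃ p : V → V, Function.Injective p ∧ ∀ v, ¬ Near G v (p v) := by
  obtain ⟨f, hf, hk⟩ := h
  have hinj := core_label_injective hG hf hk
  have hcard := card_isCore_add_one V (t + 1)
  have hpos : 2 ≤ 2 ^ (t + 1) * (Nat.card V + 2) :=
    le_trans (by omega) (Nat.le_mul_of_pos_left (Nat.card V + 2) (by positivity))
  -- There are exactly as many core vertices as labels `0, …, k`, so no label is missed.
  have hsurj := (Function.Injective.bijective_of_nat_card_le hinj (by
    rw [Nat.card_fin]
    omega)).2
  obtain ⟨-, hf₂⟩ := isL21Labeling_iff.mp hf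
  have hH := hG.iterMycielski (t + 1)
  have key : ∀ v, ∃ w, f (.inr (.inl (botVertex w (t + 1)))) = f (.inl (topVertex v (t + 1))) ∧
      ¬ Near G v w := by
    intro v
    obtain ⟨⟨y, hy⟩, he⟩ := hsurj ⟨f (.inl (topVertex v (t + 1))), Nat.lt_succ_of_le (hk _)⟩
    have he' : f y = f (.inl (topVertex v (t + 1))) := congrArg Fin.val he
    have hfar : ¬ Near (iterMycielski G (t + 2)) (.inl (topVertex v (t + 1))) y := by
      intro hn
      have := hf₂ _ _ hn he'.symm
      subst this
      exact not_isRoot_topVertex v (t + 1) hy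
    rcases y with y | y | b
    · exact absurd (IsRoot.near hG (t := t + 2) (x := .inl y)
        (show IsRoot (t + 1) y from hy) _).symm hfar
    · obtain ⟨w, rfl, hw⟩ := exists_eq_botVertex_of_not_near_topVertex hG
        (mt (near_inl_copy hH).mpr hfar)
      exact ⟨w, he', hw⟩
    · exact absurd (near_root hH b _).symm hfar
  choose p hp hfar using key
  refine ⟨p, fun v w h => ?_, hfar⟩
  -- With at least two Mycielski steps these vertices are originals of copies, hence pairwise near
  -- and distinctly labeled.
  have h₁ := hf₂ (.inl (topVertex v (t + 1))) (.inl (topVertex w (t + 1)))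
    (near_inl_inl.mpr near_copy_copy) (by rw [← hp v, ← hp w, h])
  have inj : ∀ s, topVertex v s = topVertex w s → v = w := by
    intro s
    induction s with
    | zero => exact id
    | succ s ih => exact fun h => ih (Sum.inl_injective (Sum.inr_injective h))
  exact inj _ (Sum.inl_injective h₁)

/-! ### Labelings that extend to the Mycielski graph -/

/-- The graph has an `L(2,1)`-labeling with labels at most `k` and a two-colouring of its vertices
that separates vertices with the same label and is constant on the label `0`. -/
def HasSplitLabeling (G : SimpleGraph V) (k : ℕ) : Prop :=
  ∃ (f : V → ℕ) (s : V → Bool), (∀ x, f x ≤ k) ∧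
    (∀ x y, G.Adj x y → f x + 2 ≤ f y ∨ f y + 2 ≤ f x) ∧
    (∀ x y, f x = f y → x ≠ y → ¬ Near G x y ∧ s x ≠ s y) ∧ ∀ x, f x = 0 → s x = false

theorem HasSplitLabeling.hasL21Labeling {k : ℕ} (h : HasSplitLabeling G k) :
    HasL21Labeling G k := by
  obtain ⟨f, s, hk, h₁, h₂, -⟩ := h
  refine ⟨f, isL21Labeling_iff.mpr ⟨h₁, fun x y hn he => ?_⟩, hk⟩
  by_contra hne
  exact (h₂ x y he hne).1 hn

/-- Label `i` becomes the two labels `2i+1` and `2i+2`, the root taking `0`. A vertex and its copy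
get different ones of the two, so each new class pairs an original with the copy of its former
partner, which is far from it. -/
theorem HasSplitLabeling.mycielski (hG : NoIsolated G) {k : ℕ} (h : HasSplitLabeling G k) :
    HasSplitLabeling (mycielski G) (2 * k + 2) := by
  obtain ⟨f, s, hk, h₁, h₂, h₀⟩ := h
  let F : MycielskiVertex V → ℕ :=
    Sum.elim (fun x => 1 + 2 * f x + (s x).toNat)
      (Sum.elim (fun x => 1 + 2 * f x + (!s x).toNat) (fun _ => 0))
  have hb : ∀ b : Bool, b.toNat ≤ 1 := by decide
  have hadj : ∀ x y, G.Adj x y → ∀ a b : ℕ, a ≤ 1 → b ≤ 1 →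
      1 + 2 * f x + a + 2 ≤ 1 + 2 * f y + b ∨ 1 + 2 * f y + b + 2 ≤ 1 + 2 * f x + a := by
    intro x y hxy a b ha hb'
    have := h₁ x y hxy
    omega
  -- Copies are adjacent to the root, so they must avoid label `1`; the colour `false` on the old
  -- label `0` ensures this.
  have hcopy : ∀ x, 2 ≤ 1 + 2 * f x + (!s x).toNat := by
    intro x
    by_cases hx : f x = 0
    · simp [h₀ x hx]
    · omega
  have heq : ∀ x y, ∀ a b : Bool, 1 + 2 * f x + a.toNat = 1 + 2 * f y + b.toNat →
      f x = f y ∧ a = b := by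
    intro x y a b h
    have h₁ := hb a
    have h₂ := hb b
    refine ⟨by omega, ?_⟩
    have : a.toNat = b.toNat := by omega
    revert this
    cases a <;> cases b <;> simp
  refine ⟨F, Sum.elim (fun _ => false) (Sum.elim (fun _ => true) (fun _ => false)), ?_, ?_, ?_, ?_⟩
  · rintro (x | x | a)
    · have := hk x
      have := hb (s x)
      change 1 + 2 * f x + (s x).toNat ≤ _
      omega
    · have := hk x
      have := hb (!s x)
      change 1 + 2 * f x + (!s x).toNat ≤ _
      omega
    · exact Nat.zero_le _
  · rintro (x | x | a) (y | y | b) h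
    · exact hadj x y h _ _ (hb _) (hb _)
    · exact hadj x y h _ _ (hb _) (hb _)
    · exact h.elim
    · exact hadj x y h _ _ (hb _) (hb _)
    · exact h.elim
    · right
      have := hcopy x
      change 0 + 2 ≤ 1 + 2 * f x + (!s x).toNat
      omega
    · exact h.elim
    · left
      have := hcopy y
      change 0 + 2 ≤ 1 + 2 * f y + (!s y).toNat
      omega
    · exact h.elim
  · have hmix : ∀ x y, 1 + 2 * f x + (s x).toNat = 1 + 2 * f y + (!s y).toNat → ¬ Near G x y := by
      intro x y he hn
      obtain ⟨he₁, he₂⟩ := heq _ _ _ _ he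
      by_cases hxy : x = y
      · subst hxy
        simp at he₂
      · exact (h₂ x y he₁ hxy).1 hn
    rintro (x | x | a) (y | y | b) he hne
    · obtain ⟨he₁, he₂⟩ := heq _ _ _ _ he
      exact absurd he₂ (h₂ x y he₁ (fun h => hne (congrArg _ h))).2
    · exact ⟨fun hn => hmix x y he ((near_inl_copy hG).mp hn), by simp⟩
    · change 1 + 2 * f x + (s x).toNat = 0 at he
      omega
    · exact ⟨fun hn => hmix y x he.symm ((near_inl_copy hG).mp hn.symm), by simp⟩
    · obtain ⟨he₁, he₂⟩ := heq _ _ _ _ he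
      exact absurd (by simpa using he₂) (h₂ x y he₁ (fun h => hne (by rw [h]))).2
    · change 1 + 2 * f x + (!s x).toNat = 0 at he
      omega
    · change 0 = 1 + 2 * f y + (s y).toNat at he
      omega
    · change 0 = 1 + 2 * f y + (!s y).toNat at he
      omega
    · exact absurd rfl hne
  · rintro (x | x | a) he
    · rfl
    · change 1 + 2 * f x + (!s x).toNat = 0 at he
      omega
    · rfl

theorem HasSplitLabeling.iterMycielski [Nonempty V] (hG : NoIsolated G) {n : ℕ}
    (h : HasSplitLabeling (iterMycielski G 2) (2 * (n + 2) - 2)) (t : ℕ) :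
    HasSplitLabeling (iterMycielski G (t + 2)) (2 ^ (t + 1) * (n + 2) - 2) := by
  induction t with
  | zero => simpa using h
  | succ t ih =>
    have hpos : 2 ≤ 2 ^ (t + 1) * (n + 2) :=
      le_trans (by omega) (Nat.le_mul_of_pos_left (n + 2) (by positivity))
    have := ih.mycielski (hG.iterMycielski (t + 2))
    rwa [show 2 * (2 ^ (t + 1) * (n + 2) - 2) + 2 = 2 ^ (t + 1 + 1) * (n + 2) - 2 by
      rw [pow_succ 2 (t + 1), mul_right_comm]
      omega] at this


/-! ### A Hamiltonian path through the label classes of `M²(G)` -/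

/-- A permutation that moves every vertex to distance greater than `2`. -/
def IsFar (G : SimpleGraph V) (p : Equiv.Perm V) : Prop := ∀ v, ¬ Near G v (p v)

theorem IsFar.not_adj {p : Equiv.Perm V} (hp : IsFar G p) (v : V) : ¬ G.Adj v (p v) :=
  fun h => hp v (Or.inr (Or.inl h))

theorem IsFar.not_adj' {p : Equiv.Perm V} (hp : IsFar G p) (v : V) : ¬ G.Adj (p v) v :=
  fun h => hp.not_adj v h.symm

theorem IsFar.not_adj_of_adj {p : Equiv.Perm V} (hp : IsFar G p) {v w : V} (h : G.Adj w v) :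
    ¬ G.Adj w (p v) :=
  fun h' => hp v (Or.inr (Or.inr ⟨w, h.symm, h'⟩))

theorem IsFar.ne {p : Equiv.Perm V} (hp : IsFar G p) (v : V) : p v ≠ v :=
  fun h => hp v (Or.inl h.symm)

/-- Compatibility of label classes in `M²(G)`. The pair `(v, true)` stands for the class of the
copy of the copy of `v` and the original of the original of `p v`, and `(v, false)` for the class
of the copy of the original of `v` and the original of the copy of `p v`. -/
def Compatible (G : SimpleGraph V) (p : Equiv.Perm V) : V × Bool → V × Bool → Prop
  | (v, true), (w, true) => ¬ G.Adj (p v) (p w) ∧ ¬ G.Adj v (p w) ∧ ¬ G.Adj w (p v)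
  | (v, true), (w, false) => ¬ G.Adj (p v) w ∧ ¬ G.Adj (p v) (p w)
  | (v, false), (w, true) => ¬ G.Adj (p w) v ∧ ¬ G.Adj (p w) (p v)
  | (v, false), (w, false) => ¬ G.Adj v (p w) ∧ ¬ G.Adj w (p v)

/-- The list `(x, true), (p x, false)` with `x` running through `l`. -/
def pairList (p : Equiv.Perm V) (l : List V) : List (V × Bool) :=
  l.flatMap fun x => [(x, true), (p x, false)]

theorem pairList_cons (p : Equiv.Perm V) (x : V) (l : List V) :
    pairList p (x :: l) = (x, true) :: (p x, false) :: pairList p l := rfl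

theorem mem_pairList_true {p : Equiv.Perm V} {l : List V} {x : V} :
    (x, true) ∈ pairList p l ↔ x ∈ l := by
  simp [pairList]

theorem mem_pairList_false {p : Equiv.Perm V} {l : List V} {x : V} :
    (x, false) ∈ pairList p l ↔ p.symm x ∈ l := by
  simp only [pairList, List.mem_flatMap, List.mem_cons, Prod.mk.injEq, List.not_mem_nil]
  constructor
  · rintro ⟨a, ha, h⟩
    obtain rfl : x = p a := by simpa using h
    simpa using ha
  · exact fun h => ⟨_, h, by simp⟩

theorem nodup_pairList (p : Equiv.Perm V) {l : List V} (hl : l.Nodup) : (pairList p l).Nodup := by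
  induction l with
  | nil => simp [pairList]
  | cons x l ih =>
    rw [List.nodup_cons] at hl
    rw [pairList_cons, List.nodup_cons, List.nodup_cons, List.mem_cons, mem_pairList_true,
      mem_pairList_false]
    simpa [hl.1] using ih hl.2

/-- Every edge forbidden here is either a loop or joins some `y` to `p y`. -/
theorem isChain_pairList_iterate {p : Equiv.Perm V} (hp : IsFar G p) (n : ℕ) (x : V) :
    (pairList p (List.iterate p x n)).IsChain (Compatible G p) := by
  induction n generalizing x with
  | zero => simp [pairList]
  | succ n ih =>
    have h₁ : Compatible G p (x, true) (p x, false) := ⟨G.irrefl, hp.not_adj _⟩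
    rw [List.iterate, pairList_cons, List.isChain_cons_cons]
    refine ⟨h₁, ?_⟩
    cases n with
    | zero => simp [pairList]
    | succ n =>
      have := ih (p x)
      rw [List.iterate, pairList_cons] at this ⊢
      exact List.isChain_cons_cons.mpr ⟨⟨hp.not_adj' _, G.irrefl⟩, this⟩

theorem exists_getLast?_pairList (p : Equiv.Perm V) {l : List V} (hl : l ≠ []) :
    ∃ b, (pairList p l).getLast? = some (b, false) := by
  obtain ⟨l', x, rfl⟩ := List.eq_nil_or_concat l |>.resolve_left hl
  exact ⟨p x, by simp [pairList]⟩

/-- A path of compatible classes through some of the cycles of `p`, from a class of the form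
`(a, true)` to one of the form `(b, false)`. -/
structure IsPartialPath (G : SimpleGraph V) (p : Equiv.Perm V) (L : List (V × Bool)) : Prop where
  isChain : L.IsChain (Compatible G p)
  nodup : L.Nodup
  closed : ∀ v w d e, p.SameCycle v w → (v, d) ∈ L → (w, e) ∈ L
  head : ∃ a, L.head? = some (a, true)
  last : ∃ b, L.getLast? = some (b, false)

theorem IsPartialPath.append {p : Equiv.Perm V} {L M : List (V × Bool)}
    (hL : IsPartialPath G p L) {c : V} (hc : ∀ d, (c, d) ∉ L) (hchain : M.IsChain (Compatible G p))
    (hM : M.Nodup) (hmem : ∀ x d, (x, d) ∈ M ↔ p.SameCycle c x)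
    (hlast : ∃ b, M.getLast? = some (b, false))
    (hlink : ∀ a ∈ L.getLast?, ∀ b ∈ M.head?, Compatible G p a b) :
    IsPartialPath G p (L ++ M) where
  isChain := List.isChain_append.mpr ⟨hL.isChain, hchain, hlink⟩
  nodup := by
    refine hL.nodup.append hM ?_
    rintro ⟨x, d⟩ hx hx'
    exact hc d (hL.closed _ _ _ _ ((hmem x d).mp hx').symm hx)
  closed v w d e h hv := by
    rw [List.mem_append] at hv ⊢
    rw [hmem] at hv ⊢
    exact hv.imp (hL.closed _ _ _ _ h) (fun h' => h'.trans h)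
  head := by
    obtain ⟨a, ha⟩ := hL.head
    exact ⟨a, by simp [List.head?_append, ha]⟩
  last := by
    obtain ⟨b, hb⟩ := hlast
    exact ⟨b, by simp [List.getLast?_append, hb]⟩

/-! ### Linking the cycles of `p` into one path -/

section

variable [Fintype V] [DecidableEq V]

theorem mem_toList_of_isFar {p : Equiv.Perm V} (hp : IsFar G p) {x y : V} :
    y ∈ p.toList x ↔ p.SameCycle x y := by
  rw [Equiv.Perm.mem_toList_iff, and_iff_left (Equiv.Perm.mem_support.mpr (hp.ne x))]

theorem mem_pairList_toList {p : Equiv.Perm V} (hp : IsFar G p) {x y : V} {d : Bool} :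
    (y, d) ∈ pairList p (p.toList x) ↔ p.SameCycle x y := by
  cases d
  · rw [mem_pairList_false, mem_toList_of_isFar hp]
    exact Equiv.Perm.sameCycle_symm_apply_right
  · rw [mem_pairList_true, mem_toList_of_isFar hp]

theorem exists_toList_eq_cons {p : Equiv.Perm V} (hp : IsFar G p) (x : V) :
    ∃ l, p.toList x = x :: l := by
  have h := Equiv.Perm.toList_getElem_zero p x (Equiv.Perm.mem_support.mpr (hp.ne x))
  have h' : p.toList x ≠ [] := List.ne_nil_of_mem ((mem_toList_of_isFar hp).mpr (.refl p x))
  obtain ⟨a, l, hl⟩ := List.exists_cons_of_ne_nil h'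
  simp only [hl, List.getElem_cons_zero] at h
  exact ⟨l, by rw [hl, h]⟩

theorem isPartialPath_pairList_toList {p : Equiv.Perm V} (hp : IsFar G p) (x : V) :
    IsPartialPath G p (pairList p (p.toList x)) where
  isChain := isChain_pairList_iterate hp _ _
  nodup := nodup_pairList p (p.nodup_toList x)
  closed v w d e h hv := by
    rw [mem_pairList_toList hp] at hv ⊢
    exact hv.trans h
  head := by
    obtain ⟨l, hl⟩ := exists_toList_eq_cons hp x
    exact ⟨x, by rw [hl]; rfl⟩
  last := by
    obtain ⟨l, hl⟩ := exists_toList_eq_cons hp x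
    exact exists_getLast?_pairList p (by simp [hl])

/-- If the two ends of a far pair dominate a cycle of `p`, then `p` can be replaced on this cycle
by an involution. -/
theorem exists_involutive_on_cycle {p : Equiv.Perm V} (hp : IsFar G p) {v c : V}
    (h : ∀ x, p.SameCycle c x → G.Adj v x ∨ G.Adj (p v) x) :
    ∃ q : Equiv.Perm V, IsFar G q ∧ (∀ x, p.SameCycle c x → q (q x) = x) ∧
      ∀ x, ¬ p.SameCycle c x → q x = p x := by
  classical
  -- The far vertices `x` and `p x` have no common neighbour, so neighbours of `v` and of `p v`
  -- alternate along the cycle.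
  have h_ab : ∀ x, p.SameCycle c x → (G.Adj v (p x) ↔ ¬ G.Adj v x) := by
    intro x hx
    refine ⟨fun h₁ h₂ => hp.not_adj_of_adj h₂ h₁, fun h₁ => ?_⟩
    have h₂ := (h x hx).resolve_left h₁
    exact (h (p x) (Equiv.Perm.sameCycle_apply_right.mpr hx)).resolve_right
      (hp.not_adj_of_adj h₂)
  -- By the alternation, swapping each neighbour `x` of `v` on the cycle with `p x` pairs off the
  -- whole cycle.
  let q : V → V := fun x =>
    if p.SameCycle c x then if G.Adj v x then p x else p.symm x else p x
  have q_out : ∀ x, ¬ p.SameCycle c x → q x = p x := fun x hx => if_neg hx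
  have q_mem : ∀ x, p.SameCycle c x → p.SameCycle c (q x) := by
    intro x hx
    simp only [q, if_pos hx]
    split_ifs
    · exact Equiv.Perm.sameCycle_apply_right.mpr hx
    · exact Equiv.Perm.sameCycle_symm_apply_right.mpr hx
  have q_invol : ∀ x, p.SameCycle c x → q (q x) = x := by
    intro x hx
    have hqx := q_mem x hx
    by_cases hv : G.Adj v x
    · have e : q x = p x := by simp only [q, if_pos hx, if_pos hv]
      rw [e] at hqx ⊢
      simp only [q, if_pos hqx, if_neg (mt (h_ab x hx).mp (not_not.mpr hv)),
        Equiv.symm_apply_apply]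
    · have e : q x = p.symm x := by simp only [q, if_pos hx, if_neg hv]
      rw [e] at hqx ⊢
      have : G.Adj v (p.symm x) := by
        have := h_ab _ hqx
        rw [Equiv.apply_symm_apply] at this
        by_contra h'
        exact hv (this.mpr h')
      simp only [q, if_pos hqx, if_pos this, Equiv.apply_symm_apply]
  have q_inj : Function.Injective q := by
    intro x y hxy
    by_cases hx : p.SameCycle c x
    · by_cases hy : p.SameCycle c y
      · rw [← q_invol x hx, hxy, q_invol y hy]
      · have := q_mem x hx
        rw [hxy, q_out y hy] at this
        exact absurd (Equiv.Perm.sameCycle_apply_right.mp this) hy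
    · by_cases hy : p.SameCycle c y
      · have := q_mem y hy
        rw [← hxy, q_out x hx] at this
        exact absurd (Equiv.Perm.sameCycle_apply_right.mp this) hx
      · rw [q_out x hx, q_out y hy] at hxy
        exact p.injective hxy
  refine ⟨Equiv.ofBijective q (Finite.injective_iff_bijective.mp q_inj), fun x => ?_,
    q_invol, q_out⟩
  change ¬ Near G x (q x)
  simp only [q]
  split_ifs
  · exact hp x
  · intro hn
    have := hp (p.symm x)
    rw [Equiv.apply_symm_apply] at this
    exact this hn.symm
  · exact hp x

/-- The number of vertices on cycles of `p` of length at most `2`. -/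
def involutiveCard (p : Equiv.Perm V) : ℕ := (Finset.univ.filter fun x => p (p x) = x).card

theorem involutive_on_cycle_of_maximal {p : Equiv.Perm V} (hp : IsFar G p)
    (hmax : ∀ q, IsFar G q → involutiveCard q ≤ involutiveCard p) {v c : V}
    (h : ∀ x, p.SameCycle c x → G.Adj v x ∨ G.Adj (p v) x) {x : V} (hx : p.SameCycle c x) :
    p (p x) = x := by
  obtain ⟨q, hq, h₁, h₂⟩ := exists_involutive_on_cycle hp h
  by_contra hne
  refine absurd (hmax q hq) (not_le.mpr (Finset.card_lt_card ?_))
  rw [Finset.ssubset_iff_of_subset]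
  · exact ⟨x, by simpa using h₁ x hx, by simpa using hne⟩
  · intro y hy
    simp only [Finset.mem_filter, Finset.mem_univ, true_and] at hy ⊢
    by_cases hc : p.SameCycle c y
    · exact h₁ y hc
    · rw [h₂ y hc, h₂ _ (mt Equiv.Perm.sameCycle_apply_right.mp hc), hy]

/-- A path ending in `(v, false)` can continue with `(w, true)` when `p w` is adjacent to neither
`v` nor `p v`. If a new cycle offers no such `w`, maximality of `p` makes it a transposition, which
is traversed in another order. -/
theorem IsPartialPath.extend {p : Equiv.Perm V} (hp : IsFar G p)
    (hmax : ∀ q, IsFar G q → involutiveCard q ≤ involutiveCard p) {L : List (V × Bool)}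
    (hL : IsPartialPath G p L) {c : V} {d : Bool} (hc : (c, d) ∉ L) :
    ∃ L', IsPartialPath G p L' ∧ L.length < L'.length := by
  have hc' : ∀ e, (c, e) ∉ L := fun e h => hc (hL.closed _ _ _ _ (.refl p c) h)
  have hlen : ∀ M : List (V × Bool), (∀ x e, (x, e) ∈ M ↔ p.SameCycle c x) →
      L.length < (L ++ M).length := by
    intro M hM
    have := List.length_pos_of_mem ((hM c true).mpr (.refl p c))
    rw [List.length_append]
    omega
  obtain ⟨v, hv⟩ := hL.last
  by_cases h : ∀ x, p.SameCycle c x → G.Adj v x ∨ G.Adj (p v) x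
  · have hinv := fun x => involutive_on_cycle_of_maximal hp hmax h (x := x)
    obtain ⟨w, hw, h₁, h₂⟩ : ∃ w, p.SameCycle c w ∧ G.Adj v w ∧ G.Adj (p v) (p w) := by
      have hcc := Equiv.Perm.SameCycle.refl p c
      have hcp := Equiv.Perm.sameCycle_apply_right.mpr hcc
      rcases h c hcc with h' | h'
      · exact ⟨c, hcc, h', (h _ hcp).resolve_left (hp.not_adj_of_adj h')⟩
      · refine ⟨p c, hcp, (h _ hcp).resolve_right (hp.not_adj_of_adj h'), ?_⟩
        rwa [hinv c hcc]
    have hww := hinv w hw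
    have hcyc : ∀ x, p.SameCycle c x → x = w ∨ x = p w := by
      intro x hx
      obtain ⟨n, -, hn⟩ := (hw.symm.trans hx).exists_pow_eq'
      have : ∀ n : ℕ, (p ^ n) w = w ∨ (p ^ n) w = p w := by
        intro n
        induction n with
        | zero => exact Or.inl rfl
        | succ n ih =>
          rw [pow_succ', Equiv.Perm.mul_apply]
          rcases ih with h | h <;> rw [h]
          · exact Or.inr rfl
          · exact Or.inl hww
      rw [← hn]
      exact this n
    -- Entering at `(w, false)` is allowed because `v` is adjacent to `w` and `p v` to `p w`; the
    -- step between the two `true` classes uses `p (p w) = w`.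
    let M : List (V × Bool) := [(w, false), (w, true), (p w, true), (p w, false)]
    have hmem : ∀ x e, (x, e) ∈ M ↔ p.SameCycle c x := by
      intro x e
      constructor
      · intro hx
        have : x = w ∨ x = p w := by
          simp only [M, List.mem_cons, Prod.mk.injEq, List.not_mem_nil] at hx
          tauto
        rcases this with rfl | rfl
        · exact hw
        · exact Equiv.Perm.sameCycle_apply_right.mpr hw
      · intro hx
        rcases hcyc x hx with rfl | rfl <;> cases e <;> simp [M]
    refine ⟨L ++ M, hL.append hc' ?_ ?_ hmem ⟨p w, rfl⟩ ?_, hlen M hmem⟩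
    · simp only [M, List.isChain_cons_cons, List.isChain_singleton, and_true]
      refine ⟨⟨hp.not_adj' _, G.irrefl⟩, ⟨?_, ?_, G.irrefl⟩, hp.not_adj' _, G.irrefl⟩
      · rw [hww]
        exact hp.not_adj' _
      · rw [hww]
        exact G.irrefl
    · have := hp.ne w
      simp [M, this.symm]
    · intro a ha b hb
      rw [hv] at ha
      simp only [M, List.head?_cons, Option.mem_def, Option.some.injEq] at ha hb
      subst ha hb
      refine ⟨hp.not_adj_of_adj h₁, fun h' => ?_⟩
      exact hp v (Or.inr (Or.inr ⟨w, h₁, h'⟩))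
  · push Not at h
    obtain ⟨x, hx, h₁, h₂⟩ := h
    -- Starting the cycle at the preimage of `x` makes `x` the vertex tested against `v` and `p v`.
    have hw : p.SameCycle c (p.symm x) := Equiv.Perm.sameCycle_symm_apply_right.mpr hx
    set w := p.symm x with hwdef
    have hpw : p w = x := p.apply_symm_apply x
    have hpath := isPartialPath_pairList_toList hp w
    have hmem : ∀ y e, (y, e) ∈ pairList p (p.toList w) ↔ p.SameCycle c y := by
      intro y e
      rw [mem_pairList_toList hp]
      exact ⟨hw.trans, hw.symm.trans⟩
    refine ⟨_, hL.append hc' hpath.isChain hpath.nodup hmem hpath.last ?_, hlen _ hmem⟩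
    intro a ha b hb
    obtain ⟨l, hl⟩ := exists_toList_eq_cons hp w
    rw [hl, pairList_cons] at hb
    rw [hv] at ha
    simp only [List.head?_cons, Option.mem_def, Option.some.injEq] at ha hb
    subst ha hb
    refine ⟨?_, ?_⟩
    · rw [hpw]
      exact fun h => h₁ h.symm
    · rw [hpw]
      exact fun h => h₂ h.symm

/-- Here `n` bounds the number of classes still missing. -/
theorem IsPartialPath.exists_hamiltonian {p : Equiv.Perm V} (hp : IsFar G p)
    (hmax : ∀ q, IsFar G q → involutiveCard q ≤ involutiveCard p) (n : ℕ) {L : List (V × Bool)}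
    (hL : IsPartialPath G p L) (hn : Fintype.card (V × Bool) ≤ L.length + n) :
    ∃ L', IsPartialPath G p L' ∧ ∀ x, x ∈ L' := by
  induction n generalizing L with
  | zero =>
    refine ⟨L, hL, fun x => ?_⟩
    have h := L.toFinset.eq_univ_of_card (by
      have := Finset.card_le_univ L.toFinset
      rw [List.toFinset_card_of_nodup hL.nodup] at this ⊢
      omega)
    rw [← List.mem_toFinset, h]
    exact Finset.mem_univ x
  | succ n ih =>
    by_cases h : ∀ x, x ∈ L
    · exact ⟨L, hL, h⟩
    · push Not at h
      obtain ⟨⟨c, d⟩, hc⟩ := h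
      obtain ⟨L', hL', hlt⟩ := hL.extend hp hmax hc
      exact ih hL' (by omega)

/-- The classes can be numbered so that consecutive ones are compatible and the first one is of
the form `(a, true)`. -/
theorem exists_numbering [Nonempty V] {p₀ : Equiv.Perm V} (hp₀ : IsFar G p₀) :
    ∃ (p : Equiv.Perm V) (g : V × Bool → ℕ), IsFar G p ∧ Function.Injective g ∧
      (∀ x, g x < 2 * Fintype.card V) ∧ (∀ x y, g y = g x + 1 → Compatible G p x y) ∧
      ∀ v, g (v, false) ≠ 0 := by
  classical
  obtain ⟨p, hp, hmax⟩ := Finset.exists_max_image (Finset.univ.filter fun q => IsFar G q)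
    involutiveCard ⟨p₀, by simpa using hp₀⟩
  simp only [Finset.mem_filter, Finset.mem_univ, true_and] at hp hmax
  obtain ⟨L, hL, hall⟩ := (isPartialPath_pairList_toList hp (Classical.arbitrary V)
    ).exists_hamiltonian hp hmax (Fintype.card (V × Bool)) (by omega)
  have hlt : ∀ x, L.idxOf x < L.length := fun x => List.idxOf_lt_length_of_mem (hall x)
  refine ⟨p, fun x => L.idxOf x, hp, ?_, ?_, ?_, ?_⟩
  · intro x y h
    exact (List.idxOf_inj (hall x)).mp h
  · intro x
    have h₁ := hL.nodup.length_le_card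
    rw [Fintype.card_prod, Fintype.card_bool] at h₁
    have h₂ := hlt x
    dsimp only
    omega
  · intro x y h
    have := List.isChain_iff_getElem.mp hL.isChain (L.idxOf x) (by rw [← h]; exact hlt y)
    simp only [← h] at this
    rwa [List.getElem_idxOf, List.getElem_idxOf] at this
  · intro v h
    obtain ⟨a, ha⟩ := hL.head
    cases L with
    | nil => simp at ha
    | cons b L =>
      simp only [List.head?_cons, Option.some.injEq] at ha
      subst ha
      simp at h

end


/-! ### The labeling of `M²(G)` -/

theorem compatible_symm {p : Equiv.Perm V} {a b : V × Bool} (h : Compatible G p a b) :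
    Compatible G p b a := by
  obtain ⟨v, _ | _⟩ := a <;> obtain ⟨w, _ | _⟩ := b
  · exact ⟨h.2, h.1⟩
  · exact h
  · exact h
  · exact ⟨fun h' => h.1 h'.symm, h.2.2, h.2.1⟩

theorem IsFar.compatible_self {p : Equiv.Perm V} (hp : IsFar G p) (a : V × Bool) :
    Compatible G p a a := by
  obtain ⟨v, _ | _⟩ := a
  · exact ⟨hp.not_adj v, hp.not_adj v⟩
  · exact ⟨G.irrefl, hp.not_adj v, hp.not_adj v⟩

theorem IsFar.hasSplitLabeling [Fintype V] [Nonempty V] (hG : NoIsolated G)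
    {p₀ : Equiv.Perm V} (hp₀ : IsFar G p₀) :
    HasSplitLabeling (iterMycielski G 2) (2 * (Fintype.card V + 2) - 2) := by
  classical
  obtain ⟨p, g, hp, g_inj, g_lt, g_comp, g_zero⟩ := exists_numbering hp₀
  have hM : NoIsolated (mycielski G) := hG.mycielski
  have hsep : ∀ a b, ¬ Compatible G p a b → 3 + g a + 2 ≤ 3 + g b ∨ 3 + g b + 2 ≤ 3 + g a := by
    intro a b h
    have h₁ : g a ≠ g b := by
      intro h'
      rw [g_inj h'] at h
      exact h (hp.compatible_self b)
    have h₂ : g b ≠ g a + 1 := fun h' => h (g_comp _ _ h')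
    have h₃ : g a ≠ g b + 1 := fun h' => h (compatible_symm (g_comp _ _ h'))
    omega
  -- Labels `0`, `1`, `2` go to the last root, the first root and the copy of the first root; the
  -- path positions supply the `2n` labels from `3` on.
  let F : MycielskiVertex (MycielskiVertex V) → ℕ :=
    Sum.elim
      (Sum.elim (fun v => 3 + g (p.symm v, true))
        (Sum.elim (fun v => 3 + g (p.symm v, false)) fun _ => 1))
      (Sum.elim
        (Sum.elim (fun v => 3 + g (v, false)) (Sum.elim (fun v => 3 + g (v, true)) fun _ => 2))
        fun _ => 0)
  let s : MycielskiVertex (MycielskiVertex V) → Bool :=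
    Sum.elim (fun _ => false) (Sum.elim (fun _ => true) fun _ => false)
  have hfar : ∀ v w, p.symm v = w → ¬ Near G v w := by
    rintro v w rfl hn
    have := hp (p.symm v)
    rw [Equiv.apply_symm_apply] at this
    exact this hn.symm
  change HasSplitLabeling (mycielski (mycielski G)) _
  refine ⟨F, s, ?_, ?_, ?_, ?_⟩
  · rintro ((v | v | a) | (v | v | a) | a) <;> simp only [F, Sum.elim_inl, Sum.elim_inr]
    · have := g_lt (p.symm v, true)
      omega
    · have := g_lt (p.symm v, false)
      omega
    · omega
    · have := g_lt (v, false)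
      omega
    · have := g_lt (v, true)
      omega
    · omega
    · omega
  -- The copy of the first root, labeled `2`, is adjacent to the originals of copies, so label `3`
  -- must fall on a `true` class.
  · have hroot : ∀ v, 2 + 2 ≤ 3 + g (v, false) := by
      intro v
      have := g_zero v
      omega
    rintro ((v | v | a) | (v | v | a) | a) ((w | w | b) | (w | w | b) | b) h
    all_goals first
      | exact False.elim h
      | (replace h : G.Adj v w := h
         refine hsep _ _ fun hc => ?_
         simp only [Compatible, Equiv.apply_symm_apply] at hc
         first
           | exact hc.1 h
           | exact hc.2 h
           | exact hc.1 h.symm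
           | exact hc.2 h.symm
           | exact hc.2.1 h
           | exact hc.2.2 h
           | exact hc.2.1 h.symm
           | exact hc.2.2 h.symm)
      | exact Or.inl (hroot _)
      | exact Or.inr (hroot _)
      | (simp only [F, Sum.elim_inl, Sum.elim_inr]
         omega)
  · have hcopy : ∀ v w, p.symm v = w →
        ¬ Near (mycielski (mycielski G)) (.inl (.inl v)) (.inr (.inl (.inr (.inl w)))) :=
      fun v w h hn => hfar v w h ((near_inl_copy hG).mp ((near_inl_copy hM).mp hn))
    have hcopy' : ∀ v w, p.symm v = w →
        ¬ Near (mycielski (mycielski G)) (.inl (.inr (.inl v))) (.inr (.inl (.inl w))) :=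
      fun v w h hn => hfar v w h ((near_inl_copy hG).mp ((near_inl_copy hM).mp hn).symm).symm
    rintro ((v | v | a) | (v | v | a) | a) ((w | w | b) | (w | w | b) | b) he hne
    all_goals
      simp only [F, Sum.elim_inl, Sum.elim_inr, Nat.add_left_cancel_iff] at he
    all_goals first
      | exact absurd rfl hne
      | omega
      | (replace he := g_inj he
         rw [Prod.mk.injEq] at he
         first
           | exact absurd he.2 (by decide)
           | (replace he := p.symm.injective he.1
              subst he
              exact absurd rfl hne)
           | (replace he := he.1
              subst he
              exact absurd rfl hne)
           | exact ⟨hcopy _ _ he.1, by simp [s]⟩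
           | exact ⟨hcopy' _ _ he.1, by simp [s]⟩
           | exact ⟨fun hn => hcopy _ _ he.1.symm hn.symm, by simp [s]⟩
           | exact ⟨fun hn => hcopy' _ _ he.1.symm hn.symm, by simp [s]⟩)
  · rintro ((v | v | a) | (v | v | a) | a) he
    all_goals
      simp only [F, Sum.elim_inl, Sum.elim_inr] at he
    all_goals first
      | rfl
      | omega

/-! ### Perfect `2`-matchings and Hall's condition -/

theorem mem_D₂ {S : Set V} {x : V} : x ∈ D₂ G S ↔ ∃ v ∈ S, ¬ Near G v x := by
  simp only [D₂, Set.mem_ofPred_eq, two_lt_edist_iff_not_near]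
  exact exists_congr fun v => and_congr_right fun _ => not_congr ⟨Near.symm, Near.symm⟩

theorem square_compl_adj {x y : V} : (square G)ᶜ.Adj x y ↔ ¬ Near G x y := by
  rw [SimpleGraph.compl_adj]
  simp only [square, edist_le_two_iff_near]
  constructor
  · exact fun h hn => h.2 ⟨h.1, hn⟩
  · exact fun h => ⟨fun h' => h (Or.inl h'), fun h' => h h'.2⟩

theorem exists_isFar_of_forall_ncard_le [Fintype V]
    (h : ∀ S : Set V, S.ncard ≤ (D₂ G S).ncard) : ∃ p : Equiv.Perm V, IsFar G p := by
  classical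
  obtain ⟨f, hf, hfar⟩ := (Fintype.all_card_le_filter_rel_iff_exists_injective
    (fun x y => ¬ Near G x y)).mp (by
      intro A
      have hA := h (A : Set V)
      rw [Set.ncard_coe_finset] at hA
      have hD : D₂ G (A : Set V) =
          (Finset.univ.filter fun b => ∃ a ∈ A, ¬ Near G a b : Finset V) := by
        ext x
        simp [mem_D₂]
      rw [hD, Set.ncard_coe_finset] at hA
      exact hA)
  exact ⟨Equiv.ofBijective f (Finite.injective_iff_bijective.mp hf), hfar⟩

theorem forall_ncard_le_of_injective [Finite V] {f : V → V} (hf : Function.Injective f)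
    (hfar : ∀ v, ¬ Near G v (f v)) (S : Set V) : S.ncard ≤ (D₂ G S).ncard := by
  rw [← Set.ncard_image_of_injective S hf]
  refine Set.ncard_le_ncard ?_
  rintro _ ⟨v, hv, rfl⟩
  exact mem_D₂.mpr ⟨v, hv, hfar v⟩

theorem IsFar.hasPerfectTwoMatching [Fintype V] {p : Equiv.Perm V} (hp : IsFar G p) :
    HasPerfectTwoMatching (square G)ᶜ := by
  classical
  refine ⟨Sym2.lift ⟨fun x y => (if p x = y then 1 else 0) + if p y = x then 1 else 0,
    fun x y => add_comm _ _⟩, ?_, ?_, ?_⟩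
  · intro e
    induction e with | _ x y
    rw [Sym2.lift_mk]
    dsimp only
    split_ifs <;> omega
  · intro e he
    induction e with | _ x y
    rw [SimpleGraph.mem_edgeSet, square_compl_adj, not_not] at he
    rw [Sym2.lift_mk]
    dsimp only
    rw [if_neg, if_neg]
    · rintro rfl
      exact hp y he.symm
    · rintro rfl
      exact hp x he
  · intro x
    have h := Equiv.sum_comp p fun z => if z = x then 1 else 0
    simp only [Sym2.lift_mk, Finset.sum_add_distrib, h]
    simp

/-- All weight at `S` goes to `D₂ G S`, so `2|S|` is at most the total weight `2|D₂ G S|` available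
there. -/
theorem forall_ncard_le_of_hasPerfectTwoMatching [Fintype V]
    (h : HasPerfectTwoMatching (square G)ᶜ) (S : Set V) : S.ncard ≤ (D₂ G S).ncard := by
  classical
  obtain ⟨w, -, h₀, hsum⟩ := h
  rw [Set.ncard_eq_toFinset_card', Set.ncard_eq_toFinset_card']
  have h₁ : ∀ x ∈ S.toFinset, ∑ y ∈ (D₂ G S).toFinset, w s(x, y) = 2 := by
    intro x hx
    rw [← hsum x]
    refine Finset.sum_subset (Finset.subset_univ _) fun y _ hy => h₀ _ ?_
    rw [SimpleGraph.mem_edgeSet, square_compl_adj]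
    exact fun hn => hy (Set.mem_toFinset.mpr (mem_D₂.mpr ⟨x, Set.mem_toFinset.mp hx, hn⟩))
  have h₂ : ∑ x ∈ S.toFinset, ∑ y ∈ (D₂ G S).toFinset, w s(x, y) ≤
      ∑ y ∈ (D₂ G S).toFinset, 2 := by
    rw [Finset.sum_comm]
    refine Finset.sum_le_sum fun y _ => ?_
    rw [← hsum y]
    simp only [Sym2.eq_swap (a := y)]
    exact Finset.sum_le_sum_of_subset (Finset.subset_univ _)
  rw [Finset.sum_congr rfl h₁, Finset.sum_const, Finset.sum_const] at h₂
  simpa using h₂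

end L21Mycielski

theorem theorem4p7 {V : Type*} [Fintype V] (G : SimpleGraph V)
    (hn : 2 ≤ Fintype.card V) (hG : ∀ v, ¬ G.IsIsolated v) (t : ℕ) (ht : 2 ≤ t) :
    (L21Mycielski.lambdaNumber (L21Mycielski.iterMycielski G t)
        = 2 ^ (t - 1) * (Fintype.card V + 2) - 2 ↔
      ∀ S : Set V, S.ncard ≤ (L21Mycielski.D₂ G S).ncard) ∧
    ((∀ S : Set V, S.ncard ≤ (L21Mycielski.D₂ G S).ncard) ↔
      L21Mycielski.HasPerfectTwoMatching (L21Mycielski.square G)ᶜ) := by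
  classical
  obtain ⟨t, rfl⟩ := Nat.exists_eq_add_of_le' ht
  have hG' : L21Mycielski.NoIsolated G := by
    intro v
    simpa [SimpleGraph.IsIsolated] using hG v
  have : Nonempty V := Fintype.card_pos_iff.mp (by omega)
  rw [show t + 2 - 1 = t + 1 by omega]
  have hmem := Nat.sInf_mem (s := {k | L21Mycielski.HasL21Labeling
    (L21Mycielski.iterMycielski G (t + 2)) k}) (L21Mycielski.exists_hasL21Labeling _)
  refine ⟨⟨fun h => ?_, fun h => ?_⟩, fun h => ?_, fun h => ?_⟩
  · rw [Set.mem_ofPred_eq, ← L21Mycielski.lambdaNumber, h, ← Nat.card_eq_fintype_card] at hmem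
    obtain ⟨p, hp, hfar⟩ := L21Mycielski.exists_injective_of_hasL21Labeling hG' hmem
    exact L21Mycielski.forall_ncard_le_of_injective hp hfar
  · obtain ⟨p, hp⟩ := L21Mycielski.exists_isFar_of_forall_ncard_le h
    refine le_antisymm (Nat.sInf_le ?_) ?_
    · exact ((hp.hasSplitLabeling hG').iterMycielski hG' t).hasL21Labeling
    · rw [← Nat.card_eq_fintype_card]
      exact L21Mycielski.le_of_hasL21Labeling hG' hmem
  · obtain ⟨p, hp⟩ := L21Mycielski.exists_isFar_of_forall_ncard_le h
    exact hp.hasPerfectTwoMatching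
  · exact L21Mycielski.forall_ncard_le_of_hasPerfectTwoMatching h
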